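/- **Setting.** A gMDP $\mathbf M=(\mathbb X,\pi,\mathbb T,\mathbb A,h,\mathbb Y)$ consists of a Polish state space $\mathbb X$, a Polish control space $\mathbb A$, an initial probability measure $\pi$ on $\mathbb X$, a Borel stochastic kernel $\mathbb T(\cdot\mid x,u)$ on $\mathbb X$ given $\mathbb X\times\mathbb A$, and a measurable output map $h$ into a metric space $(\mathbb Y,\mathbf d)$; put $\mathbb T(\cdot\mid x,p)=\int\mathbb T(\cdot\mid x,u)\,p(du)$ for $p\in\mathcal P(\mathbb A)$. A Markov policy is a sequence $\mu=(\mu_0,\mu_1,\dots)$ of universally measurable maps $\mu_k:\mathbb X\to\mathcal P(\mathbb A)$. A control strategy $\mathbf C$ for $\mathbf M$ consists of a Polish space $\mathbb X_{\mathbf C}$, an initial state $c_0$, a universally measurable kernel $\mathbb T_{\mathbf C}(\cdot\mid c,x)$ on $\mathbb X_{\mathbf C}$ and a universally measurable map $h_{\mathbf C}:\mathbb X_{\mathbf C}\to\mathcal P(\mathbb A)$. The controlled model starts at $x(0)\sim\pi$, $c(0)=c_0$, and at each step draws $c(t+1)\sim\mathbb T_{\mathbf C}(\cdot\mid c(t),x(t))$,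 $u(t)\sim h_{\mathbf C}(c(t+1))$, $x(t+1)\sim\mathbb T(\cdot\mid x(t),u(t))$. Let $\mathbb P_{\mathbf C\times\mathbf M}(\lozenge^{\le N}K)$ be the probability that $h(x(t))\in K$ for some $t\in\{0,\dots,N\}$. For gMDPs $\mathbf M_1,\mathbf M_2$ over the same $\mathbb Y$, write $\mathbf M_1\preceq_\epsilon^\delta\mathbf M_2$ if there are a Borel set $R\subseteq\mathbb X_1\times\mathbb X_2$, a Borel map $U:\mathbb A_1\times\mathbb X_1\times\mathbb X_2\to\mathcal P(\mathbb A_2)$ and a Borel stochastic kernel $\mathbb W(\cdot\mid u_1,x_1,x_2)$ on $\mathbb X_1\times\mathbb X_2$ such that for all $(x_1,x_2)\in R$: $\mathbf d(h_1(x_1),h_2(x_2))\le\epsilon$, and for every $u_1\in\mathbb A_1$ the measure $\mathbb W(\cdot\mid u_1,x_1,x_2)$ has marginals $\mathbb T_1(\cdot\mid x_1,u_1)$ and $\mathbb T_2(\cdot\mid x_2,U(u_1,x_1,x_2))$ and gives $R$ mass at least $1-\delta$; and some probability measure on $\mathbb X_1\times\mathbb X_2$ has marginals $\pi_1,\pi_2$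 and gives $R$ mass at least $1-\delta$. The set $K$ is reached $(\epsilon,\delta)$-robustly with probability $p$ (by $\mathbf M_1$ with a Markov policy) if every $\mathbf M_2$ with $\mathbf M_1\preceq_\epsilon^\delta\mathbf M_2$ has a control strategy $\mathbf C_2$ with $\mathbb P_{\mathbf C_2\times\mathbf M_2}(\lozenge^{\le N}K)\ge p$. A strategy $\mathbf C_2$ for $\mathbf M_2$ *refines* a Markov policy $\mu$ of $\mathbf M_1$ along $(R,U,\mathbb W)$ if its internal state carries, measurably, a clock that starts at $-1$ and increases by one in each update, and a pair $(x_1,x_2)$, where each update sets $x_2$ to the measured state of $\mathbf M_2$; the law of the pair after the first update has marginals $\pi_1,\pi_2$ and gives $R$ mass at least $1-\delta$; and whenever the clock is $k\ge0$ and $(x_1,x_2)\in R$, the randomised control is $\int U(u_1,x_1,x_2)\,\mu_k(x_1)(du_1)$ and the next pair has law $\int\mathbb W(\cdot\mid u_1,x_1,x_2)\,\mu_k(x_1)(du_1)$. Let $\mathbf L(r)=\min(1,\max(0,r))$. For a gMDP $\mathbf M_1$, a measurable $K\subseteq\mathbb Y$, $K_{\mathbb X_1}=h_1^{-1}(K)$,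 $\delta\in\mathbb R$, and a universally measurable $\nu:\mathbb X_1\to\mathcal P(\mathbb A_1)$, put $$\mathbf T_\delta^\nu(V)(x)=\mathbf L\Big(\int_{\mathbb X_1}\big[\mathbf 1_{K_{\mathbb X_1}}+\mathbf 1_{\mathbb X_1\setminus K_{\mathbb X_1}}V\big]\,d\mathbb T_1(\cdot\mid x,\nu(x))-\delta\Big),\qquad \mathbf T_\delta^*(V)(x)=\sup_\nu\mathbf T_\delta^\nu(V)(x),$$ $$r(V)=\mathbf L\Big(\int_{\mathbb X_1}\big[\mathbf 1_{K_{\mathbb X_1}}+\mathbf 1_{\mathbb X_1\setminus K_{\mathbb X_1}}V\big]\,d\pi_1-\delta\Big).$$ For a horizon $N\ge0$ and a Markov policy $\mu$ let $V_N^{\delta,\mu}=V_N^{\delta,*}=0$, and for $k=N-1,\dots,0$ let $V_k^{\delta,\mu}=\mathbf T_\delta^{\mu_k}(V_{k+1}^{\delta,\mu})$ and $V_k^{\delta,*}=\mathbf T_\delta^*(V_{k+1}^{\delta,*})$. **Theorem.** Let $\mathbf M_1$ be a gMDP, $\mu$ a Markov policy for it, $K\subseteq\mathbb Y$ measurable,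 $N\ge0$ and $\delta\in\mathbb R$. 1. $K$ is reached $(0,\delta)$-robustly with the policy $\mu$ and with probability $r(V_0^{\delta,\mu})$. Moreover, for every $\mathbf M_2$ and every $(R,U,\mathbb W)$ witnessing $\mathbf M_1\preceq_0^\delta\mathbf M_2$ there is a strategy $\mathbf C_2$ that refines $\mu$ along $(R,U,\mathbb W)$ and satisfies $\mathbb P_{\mathbf C_2\times\mathbf M_2}(\lozenge^{\le N}K)\ge r(V_0^{\delta,\mu})$. 2. If $\mu^*$ is a Markov policy with $\mu_k^*\in\arg\sup_\nu\mathbf T_\delta^\nu(V_{k+1}^{\delta,*})$ (pointwise on $\mathbb X_1$) for all $k<N$, then $\mu^*$ is an optimal $(0,\delta)$-robust policy: $V_k^{\delta,\mu^*}=V_k^{\delta,*}$ for all $k\le N$, the set $K$ is reached $(0,\delta)$-robustly with $\mu^*$ and with probability $r(V_0^{\delta,*})$, and $r(V_0^{\delta,\mu'})\le r(V_0^{\delta,*})$ for every Markov policy $\mu'$. -/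

import Mathlib

open MeasureTheory ProbabilityTheory

universe u v w u₁ v₁ u₂ v₂ t

noncomputable section

/-! ### Universal measurability -/

/-- The universal completion of the given σ-algebra: the sets that are measurable up to a null set
for every finite measure. -/
@[reducible]
def universalSigma (α : Type u) [MeasurableSpace α] : MeasurableSpace α where
  MeasurableSet' s := ∀ m : Measure α, IsFiniteMeasure m → NullMeasurableSet s m
  measurableSet_empty _ _ := nullMeasurableSet_empty
  measurableSet_compl _ hs m hm := (hs m hm).compl
  measurableSet_iUnion _ hs m hm := NullMeasurableSet.iUnion fun i => hs i m hm

/-- A universally measurable stochastic kernel, i.e. a universally measurable map from `α` to the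
probability measures on `β` (the latter with the σ-algebra generated by `p ↦ p B`, `B` measurable;
for Polish `β` it is the Borel σ-algebra of weak convergence). -/
structure UnivKernel (α : Type u) (β : Type v) [MeasurableSpace α] [MeasurableSpace β] where
  toFun : α → Measure β
  isProb : ∀ a, IsProbabilityMeasure (toFun a)
  meas : @Measurable α (Measure β) (universalSigma α) _ toFun

instance (α : Type u) (β : Type v) [MeasurableSpace α] [MeasurableSpace β] :
    CoeFun (UnivKernel α β) (fun _ => α → Measure β) := ⟨UnivKernel.toFun⟩

/-! ### General Markov decision processes, Markov policies, control strategies -/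

/-- A general Markov decision process with output space `Y`. -/
structure GMDP (Y : Type w) [MeasurableSpace Y] where
  /-- the state space -/
  X : Type u
  /-- the control space -/
  A : Type v
  [topX : TopologicalSpace X]
  [polishX : PolishSpace X]
  [measX : MeasurableSpace X]
  [borelX : BorelSpace X]
  [topA : TopologicalSpace A]
  [polishA : PolishSpace A]
  [measA : MeasurableSpace A]
  [borelA : BorelSpace A]
  /-- the initial distribution -/
  init : Measure X
  [init_prob : IsProbabilityMeasure init]
  /-- the Borel measurable transition kernel -/
  T : Kernel (X × A) X
  [T_markov : IsMarkovKernel T]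
  /-- the output map -/
  h : X → Y
  h_meas : Measurable h

attribute [instance] GMDP.topX GMDP.polishX GMDP.measX GMDP.borelX GMDP.topA GMDP.polishA
  GMDP.measA GMDP.borelA GMDP.init_prob GMDP.T_markov

namespace GMDP

variable {Y : Type w} [MeasurableSpace Y]

/-- The transition law `T(· | x, p) = ∫ T(· | x, u) p(du)` under a randomised control `p`. -/
def trans (M : GMDP.{u, v, w} Y) (x : M.X) (p : Measure M.A) : Measure M.X :=
  p.bind fun a => M.T (x, a)

/-- A Markov policy: a sequence of universally measurable maps from the states to the probability
measures on the controls. -/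
abbrev MarkovPolicy (M : GMDP.{u, v, w} Y) : Type (max u v) := ℕ → UnivKernel M.X M.A

end GMDP

/-- A control strategy for the gMDP `M`: a Polish space of internal states, an initial internal
state, a universally measurable kernel that updates the internal state upon reading the state of
`M`, and a universally measurable map from the internal states to the randomised controls. -/
structure ControlStrategy {Y : Type w} [MeasurableSpace Y] (M : GMDP.{u, v, w} Y) where
  /-- the space of internal states -/
  XC : Type t
  [topXC : TopologicalSpace XC]
  [polishXC : PolishSpace XC]
  [measXC : MeasurableSpace XC]
  [borelXC : BorelSpace XC]
  /-- the initial internal state -/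
  c₀ : XC
  /-- the update kernel -/
  TC : UnivKernel (XC × M.X) XC
  /-- the output map -/
  hC : UnivKernel XC M.A

attribute [instance] ControlStrategy.topXC ControlStrategy.polishXC ControlStrategy.measXC
  ControlStrategy.borelXC

namespace ControlStrategy

variable {Y : Type w} [MeasurableSpace Y] {M : GMDP.{u, v, w} Y}

/-- One step of the controlled model from the pair `z = (x, c)`: draw `c' ∼ TC(· | c, x)`, draw a
control from `hC c'`, and draw `x' ∼ T(· | x, control)`. Universally measurable maps are almost
everywhere measurable for every finite measure, so that `Measure.bind` is the usual mixture. -/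
def step (C : ControlStrategy.{u, v, w, t} M) (z : M.X × C.XC) : Measure (M.X × C.XC) :=
  (C.TC (z.2, z.1)).bind fun c' => (M.trans z.1 (C.hC c')).map fun x' => (x', c')

/-- The law of the execution `(x(0), c(0)), …, (x(n), c(n))` of the controlled model on the
canonical sample space. -/
def execLaw (C : ControlStrategy.{u, v, w, t} M) : (n : ℕ) → Measure (Fin (n + 1) → M.X × C.XC)
  | 0 => M.init.map fun x _ => (x, C.c₀)
  | n + 1 => (execLaw C n).bind fun ω =>
      (C.step (ω (Fin.last n))).map fun z => Fin.snoc (α := fun _ => M.X × C.XC) ω z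

/-- The probability that the output trace of the controlled model reaches `K` at some time in
`{0, …, N}`. -/
def reachProb (C : ControlStrategy.{u, v, w, t} M) (K : Set Y) (N : ℕ) : ℝ :=
  (C.execLaw N).real {ω | ∃ i : Fin (N + 1), M.h (ω i).1 ∈ K}

end ControlStrategy

/-! ### Approximate probabilistic simulation relations -/

/-- `W` is a lifting witnessing that `Δ` and `Θ` are related by the `δ`-lifting of `R`. -/
structure IsLifting {X₁ : Type u₁} {X₂ : Type u₂} [MeasurableSpace X₁] [MeasurableSpace X₂]
    (R : Set (X₁ × X₂)) (δ : ℝ) (Δ : Measure X₁) (Θ : Measure X₂) (W : Measure (X₁ × X₂)) :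
    Prop where
  prob : IsProbabilityMeasure W
  fst_eq : W.fst = Δ
  snd_eq : W.snd = Θ
  rel_ge : 1 - δ ≤ W.real R

/-- The data witnessing that `M₁` is `(ε, δ)`-stochastically simulated by `M₂`. -/
structure Simulation {Y : Type w} [MetricSpace Y] [MeasurableSpace Y]
    (M₁ : GMDP.{u₁, v₁, w} Y) (M₂ : GMDP.{u₂, v₂, w} Y) (ε δ : ℝ) where
  /-- the relation -/
  R : Set (M₁.X × M₂.X)
  R_meas : MeasurableSet R
  /-- the Borel measurable interface function into the randomised controls -/
  U : Kernel (M₁.A × M₁.X × M₂.X) M₂.A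
  [U_markov : IsMarkovKernel U]
  /-- the Borel measurable lifting kernel -/
  W : Kernel (M₁.A × M₁.X × M₂.X) (M₁.X × M₂.X)
  [W_markov : IsMarkovKernel W]
  dist_le : ∀ x₁ x₂, (x₁, x₂) ∈ R → dist (M₁.h x₁) (M₂.h x₂) ≤ ε
  lift_trans : ∀ x₁ x₂, (x₁, x₂) ∈ R → ∀ a₁ : M₁.A,
    IsLifting R δ (M₁.T (x₁, a₁)) (M₂.trans x₂ (U (a₁, x₁, x₂))) (W (a₁, x₁, x₂))
  lift_init : ∃ W₀, IsLifting R δ M₁.init M₂.init W₀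

attribute [instance] Simulation.U_markov Simulation.W_markov

/-- `M₁ ⪯_ε^δ M₂`. -/
def IsSimulatedBy {Y : Type w} [MetricSpace Y] [MeasurableSpace Y]
    (M₁ : GMDP.{u₁, v₁, w} Y) (M₂ : GMDP.{u₂, v₂, w} Y) (ε δ : ℝ) : Prop :=
  Nonempty (Simulation M₁ M₂ ε δ)

/-- `M₁` with the Markov policy `μ` satisfies `◇^{≤ N} K` `(ε, δ)`-robustly with probability `p`:
every `M₂` that `(ε, δ)`-simulates `M₁` has a control strategy that reaches `K` within the horizon
with probability at least `p`. (As in the usual definition, the policy enters only through `p` and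
through the way in which the strategies are obtained; for the latter see `Refines`.) -/
def RobustlyReaches.{a₁, b₁, a₂, b₂, c} {Y : Type c} [MetricSpace Y] [MeasurableSpace Y]
    (M₁ : GMDP.{a₁, b₁, c} Y) (_μ : M₁.MarkovPolicy) (K : Set Y) (N : ℕ) (ε δ p : ℝ) : Prop :=
  ∀ M₂ : GMDP.{a₂, b₂, c} Y, IsSimulatedBy M₁ M₂ ε δ →
    ∃ C₂ : ControlStrategy.{a₂, b₂, c, max a₁ a₂} M₂, p ≤ C₂.reachProb K N

/-- The control strategy `C` for `M₂` refines the Markov policy `μ` for `M₁` along the simulation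
`S`: its internal state carries a clock `q` (starting at `-1`) and a pair of states
`(ξ₁, ξ₂)` of `M₁` and `M₂`, such that `ξ₂` copies the measured state of `M₂`, and, as
long as the pair is in the relation, the control is the interface applied to the policy and the
pair evolves according to the lifting kernel `W(· | μ_k(x₁), x₁, x₂)`. -/
structure Refines {Y : Type w} [MetricSpace Y] [MeasurableSpace Y]
    {M₁ : GMDP.{u₁, v₁, w} Y} {M₂ : GMDP.{u₂, v₂, w} Y} {ε δ : ℝ} (S : Simulation M₁ M₂ ε δ)
    (μ : M₁.MarkovPolicy) (C : ControlStrategy.{u₂, v₂, w, t} M₂)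
    (q : C.XC → ℤ) (ξ₁ : C.XC → M₁.X) (ξ₂ : C.XC → M₂.X) : Prop where
  q_meas : Measurable q
  ξ₁_meas : Measurable ξ₁
  ξ₂_meas : Measurable ξ₂
  clock_init : q C.c₀ = -1
  update : ∀ c x, ∀ᵐ c' ∂(C.TC (c, x)), q c' = q c + 1 ∧ ξ₂ c' = x
  init : IsLifting S.R δ M₁.init M₂.init
    ((M₂.init.bind fun x => C.TC (C.c₀, x)).map fun c' => (ξ₁ c', ξ₂ c'))
  control : ∀ c (k : ℕ), q c = k → (ξ₁ c, ξ₂ c) ∈ S.R →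
    C.hC c = (μ k (ξ₁ c)).bind fun a₁ => S.U (a₁, ξ₁ c, ξ₂ c)
  transition : ∀ c (k : ℕ), q c = k → (ξ₁ c, ξ₂ c) ∈ S.R →
    (((M₂.trans (ξ₂ c) (C.hC c)).bind fun x' => C.TC (c, x')).map fun c' => (ξ₁ c', ξ₂ c')) =
      (μ k (ξ₁ c)).bind fun a₁ => S.W (a₁, ξ₁ c, ξ₂ c)

/-! ### Robust value functions -/

/-- The truncation `L(r) = min(1, max(0, r))`. -/
def truncL (r : ℝ) : ℝ := min 1 (max 0 r)

namespace GMDP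

variable {Y : Type w} [MeasurableSpace Y]

/-- The integrand `1_{K_X} + 1_{X ∖ K_X} V` with `K_X = h⁻¹(K)`. -/
def gain (M : GMDP.{u, v, w} Y) (K : Set Y) (V : M.X → ℝ) (x : M.X) : ℝ :=
  (M.h ⁻¹' K).indicator (fun _ => 1) x + (M.h ⁻¹' K)ᶜ.indicator V x

/-- The operator `T_δ^ν`. -/
def opT (M : GMDP.{u, v, w} Y) (K : Set Y) (δ : ℝ) (ν : UnivKernel M.X M.A) (V : M.X → ℝ)
    (x : M.X) : ℝ :=
  truncL ((∫ x', M.gain K V x' ∂(M.trans x (ν x))) - δ)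

/-- The operator `T_δ^*`. -/
def opTStar (M : GMDP.{u, v, w} Y) (K : Set Y) (δ : ℝ) (V : M.X → ℝ) (x : M.X) : ℝ :=
  ⨆ ν : UnivKernel M.X M.A, M.opT K δ ν V x

/-- The value functions `V_k^δ` of a Markov policy, for the horizon `N`. -/
def value (M : GMDP.{u, v, w} Y) (K : Set Y) (δ : ℝ) (μ : M.MarkovPolicy) (N k : ℕ) : M.X → ℝ :=
  if k < N then M.opT K δ (μ k) (value M K δ μ N (k + 1)) else 0
termination_by N - k

/-- The value functions `V_k^{δ,*}`, for the horizon `N`. -/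
def valueStar (M : GMDP.{u, v, w} Y) (K : Set Y) (δ : ℝ) (N k : ℕ) : M.X → ℝ :=
  if k < N then M.opTStar K δ (valueStar M K δ N (k + 1)) else 0
termination_by N - k

/-- The robust reachability value `L(∫ [1_{K_X} + 1_{X ∖ K_X} V_0] dπ - δ)` obtained from a value
function at time `0`. -/
def robustValue (M : GMDP.{u, v, w} Y) (K : Set Y) (δ : ℝ) (V₀ : M.X → ℝ) : ℝ :=
  truncL ((∫ x, M.gain K V₀ x ∂M.init) - δ)

/-- `μ_k ∈ argsup_ν T_δ^ν(V_{k+1}^{δ,*})` for all `k < N`. -/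
def IsArgsupPolicy (M : GMDP.{u, v, w} Y) (K : Set Y) (δ : ℝ) (N : ℕ) (μ : M.MarkovPolicy) :
    Prop :=
  ∀ k < N, ∀ x, M.opT K δ (μ k) (M.valueStar K δ N (k + 1)) x =
    M.opTStar K δ (M.valueStar K δ N (k + 1)) x

end GMDP

end

/-! The strategy for `M₂` carries a simulated state `x₁` of `M₁` beside the measured state `x₂`. The
lifting kernel prescribes a joint law for the next pair, but `x₂` is produced by `M₂` itself. The
joint law is therefore disintegrated along its second coordinate, and `x₁` is drawn from the
conditional law given the measured `x₂`. On the relation the second marginal of the lifting is the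
true transition law of `M₂`, so the pair evolves exactly as prescribed (`map_bind_update`).

The bound is proved for avoidance. After the `n`-th measurement, with the pair in `R`, the
probability of avoiding `K` at the times `n + 1, …, N` is at most `1 - V_n(x₁)`; off `R` the bound
`1` is used. A lifting leaves `R` with mass at most `δ`, and for `ε = 0` outputs agree on `R`. Hence
one step costs at most `δ`, and together with the trivial bound `1` this is the truncated recursion
for `V` (`IsLifting.lintegral_le`). A supermartingale argument (`le_reachProb`) joins the steps.

Optimality is backward induction with monotonicity of the operators. Policies are only universally
measurable, so kernels are replaced by Borel ones almost everywhere, one finite measure at a time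
(`exists_kernel_ae_eq`). -/

noncomputable section

open Set
open scoped ENNReal

/-! ### Universally measurable functions -/

/-- Measurability with respect to the universal completion of the source. -/
def UnivMeasurable {α β : Type*} [MeasurableSpace α] [MeasurableSpace β] (f : α → β) : Prop :=
  @Measurable α β (universalSigma α) _ f

section UnivMeasurable

variable {α β γ : Type*} [MeasurableSpace α] [MeasurableSpace β] [MeasurableSpace γ]

theorem le_universalSigma : ‹MeasurableSpace α› ≤ universalSigma α :=
  fun _ hs _ _ => hs.nullMeasurableSet

theorem Measurable.univMeasurable {f : α → β} (hf : Measurable f) : UnivMeasurable f :=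
  fun _ hs => le_universalSigma _ (hf hs)

/-- A finite measure `m` on the source is tested through its image `m.map f`, which is again finite.
-/
theorem Measurable.measurable_universalSigma {f : α → β} (hf : Measurable f) :
    @Measurable α β (universalSigma α) (universalSigma β) f := by
  intro s hs m hm
  exact (hs (m.map f) inferInstance).preimage
    ⟨hf, Measure.AbsolutelyContinuous.rfl⟩

theorem UnivMeasurable.comp_measurable {f : β → γ} {g : α → β} (hf : UnivMeasurable f)
    (hg : Measurable g) : UnivMeasurable fun a => f (g a) :=
  fun _ hs => hg.measurable_universalSigma (hf hs)

theorem Measurable.comp_univMeasurable {f : β → γ} {g : α → β} (hf : Measurable f)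
    (hg : UnivMeasurable g) : UnivMeasurable fun a => f (g a) :=
  fun _ hs => hg (hf hs)

theorem UnivMeasurable.aemeasurable [MeasurableSpace.CountablyGenerated β] {f : α → β}
    (hf : UnivMeasurable f) (m : Measure α) [hm : IsFiniteMeasure m] : AEMeasurable f m :=
  NullMeasurable.aemeasurable fun _ hs => hf hs m hm

/-- A function that is almost everywhere equal to a universally measurable one for each finite
measure is universally measurable. -/
theorem univMeasurable_of_aemeasurable {f : α → β}
    (h : ∀ m : Measure α, IsFiniteMeasure m → AEMeasurable f m) : UnivMeasurable f :=
  fun _ hs m hm => (h m hm).nullMeasurable hs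

/-- A universally measurable kernel agrees almost everywhere with a Borel Markov kernel. -/
theorem exists_kernel_ae_eq [MeasurableSpace.CountablyGenerated β] {f : α → Measure β}
    (hf : UnivMeasurable f) (hp : ∀ a, IsProbabilityMeasure (f a)) (m : Measure α)
    [hm : IsFiniteMeasure m] :
    ∃ κ : Kernel α β, IsMarkovKernel κ ∧ ∀ᵐ a ∂m, f a = κ a := by
  classical
  rcases isEmpty_or_nonempty α with hα | ⟨⟨a₀⟩⟩
  · exact ⟨⟨f, measurable_of_empty f⟩, ⟨hp⟩, Filter.Eventually.of_forall fun _ => rfl⟩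
  -- A countable π-system generating the σ-algebra: probability measures are determined on it, and
  -- countably many exceptional null sets can be discarded together.
  set S := generateSetAlgebra (MeasurableSpace.countableGeneratingSet β) with hS
  have hSpi : IsPiSystem S := fun s hs t ht _ => isSetAlgebra_generateSetAlgebra.inter_mem hs ht
  have hSc : S.Countable :=
    countable_generateSetAlgebra MeasurableSpace.countable_countableGeneratingSet
  have hSgen : ‹MeasurableSpace β› = MeasurableSpace.generateFrom S := by
    rw [hS, generateFrom_generateSetAlgebra_eq,
      MeasurableSpace.generateFrom_countableGeneratingSet]
  have hSm : ∀ s ∈ S, MeasurableSet s := fun s hs => by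
    rw [hSgen]; exact MeasurableSpace.measurableSet_generateFrom hs
  have hae : ∀ s ∈ S, AEMeasurable (fun a => f a s) m := fun s hs =>
    ((Measure.measurable_coe (hSm s hs)).comp_univMeasurable hf).aemeasurable m
  choose! g hgm hg using hae
  have hall : ∀ᵐ a ∂m, ∀ s ∈ S, f a s = g s a := (ae_ball_iff hSc).2 hg
  obtain ⟨E, hEsub, hEm, hE⟩ := Filter.Eventually.exists_measurable_mem hall
  -- The fixed value `f a₀` off the conull Borel set `E` keeps every `φ a` a probability measure.
  let φ : α → Measure β := fun a => if a ∈ E then f a else f a₀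
  have hφp : ∀ a, IsProbabilityMeasure (φ a) := fun a => by
    by_cases ha : a ∈ E <;> simp only [φ, ha, if_true, if_false] <;> exact hp _
  have hφm : Measurable φ := by
    refine Measurable.measure_of_isPiSystem_of_isProbabilityMeasure hSgen hSpi fun s hs => ?_
    have : (fun a => φ a s) = fun a => if a ∈ E then g s a else f a₀ s := by
      funext a
      by_cases ha : a ∈ E
      · simp only [φ, ha, if_true, hE a ha s hs]
      · simp only [φ, ha, if_false]
    rw [this]
    exact Measurable.ite hEm (hgm s hs) measurable_const
  refine ⟨⟨φ, hφm⟩, ⟨hφp⟩, ?_⟩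
  filter_upwards [hEsub] with a ha
  exact (if_pos ha).symm

/-- `UnivMeasurable.aemeasurable` asks for a countably generated target, which `Measure β` is not
assumed to be; the Borel kernel serves as the measurable version. -/
theorem aemeasurable_of_univMeasurable_measure [MeasurableSpace.CountablyGenerated β]
    {f : α → Measure β} (hf : UnivMeasurable f) (hp : ∀ a, IsProbabilityMeasure (f a))
    (m : Measure α) [IsFiniteMeasure m] : AEMeasurable f m := by
  obtain ⟨κ, -, hκ⟩ := exists_kernel_ae_eq hf hp m
  exact ⟨κ, κ.measurable, hκ⟩

end UnivMeasurable

/-! ### Calculus of universally measurable kernels -/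

namespace UnivKernel

variable {α β γ ι : Type*} [MeasurableSpace α] [MeasurableSpace β] [MeasurableSpace γ]

instance (κ : UnivKernel α β) (a : α) : IsProbabilityMeasure (κ a) := κ.isProb a

theorem aemeasurable [MeasurableSpace.CountablyGenerated β] (κ : UnivKernel α β) (m : Measure α)
    [IsFiniteMeasure m] : AEMeasurable κ.toFun m :=
  aemeasurable_of_univMeasurable_measure κ.meas κ.isProb m

/-- Borel Markov kernels are universally measurable kernels. -/
def ofKernel (κ : Kernel α β) [IsMarkovKernel κ] : UnivKernel α β :=
  ⟨κ, fun _ => inferInstance, κ.measurable.univMeasurable⟩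

/-- Precomposition with a Borel map. -/
def comap (κ : UnivKernel β γ) (g : α → β) (hg : Measurable g) : UnivKernel α γ :=
  ⟨fun a => κ (g a), fun a => κ.isProb (g a), UnivMeasurable.comp_measurable κ.meas hg⟩

/-- Glueing of countably many kernels. -/
def ofFamily [MeasurableSpace ι] [Countable ι] [MeasurableSingletonClass ι]
    (F : ι → UnivKernel α β) : UnivKernel (ι × α) β where
  toFun p := F p.1 p.2
  isProb p := (F p.1).isProb p.2
  meas := by
    intro s hs
    have : (fun p : ι × α => F p.1 p.2) ⁻¹' s =
        ⋃ i, (Prod.fst ⁻¹' {i} ∩ (fun p : ι × α => F i p.2) ⁻¹' s) := by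
      ext p; simp
    rw [this]
    refine @MeasurableSet.iUnion _ _ (universalSigma _) _ _ fun i => ?_
    refine @MeasurableSet.inter _ (universalSigma _) _ _ ?_ ?_
    · exact le_universalSigma _ (measurable_fst (measurableSet_singleton i))
    · exact UnivMeasurable.comp_measurable (F i).meas measurable_snd hs

/-- Integration along a universally measurable kernel preserves universal measurability. -/
theorem univMeasurable_lintegral [MeasurableSpace.CountablyGenerated β] (κ : UnivKernel α β)
    {φ : α × β → ℝ≥0∞} (hφ : UnivMeasurable φ) :
    UnivMeasurable fun a => ∫⁻ b, φ (a, b) ∂κ a := by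
  refine univMeasurable_of_aemeasurable fun m hm => ?_
  obtain ⟨η, hη, hκη⟩ := exists_kernel_ae_eq κ.meas κ.isProb m
  -- Null sets of `m ⊗ₘ η` have `η a`-null sections for `m`-almost every `a`, so a Borel version of
  -- `φ` for this measure does not change the inner integrals.
  have hφ' := hφ.aemeasurable (m ⊗ₘ η)
  refine ⟨fun a => ∫⁻ b, hφ'.mk φ (a, b) ∂η a,
    hφ'.measurable_mk.lintegral_kernel_prod_right', ?_⟩
  filter_upwards [hκη, Measure.ae_ae_of_ae_compProd hφ'.ae_eq_mk] with a h1 h2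
  rw [h1]
  exact lintegral_congr_ae h2

/-- Composition of universally measurable kernels. -/
def bind [MeasurableSpace.CountablyGenerated β] [MeasurableSpace.CountablyGenerated γ]
    (κ : UnivKernel α β) (η : UnivKernel (α × β) γ) : UnivKernel α γ where
  toFun a := (κ a).bind fun b => η (a, b)
  isProb a := isProbabilityMeasure_bind
    ((η.comap (fun b => (a, b)) measurable_prodMk_left).aemeasurable (κ a))
    (Filter.Eventually.of_forall fun b => η.isProb (a, b))
  meas := by
    refine @Measure.measurable_of_measurable_coe _ _ _ (universalSigma α) _ fun s hs => ?_
    have : (fun a => (κ a).bind (fun b => η (a, b)) s) = fun a => ∫⁻ b, η (a, b) s ∂κ a := by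
      funext a
      exact Measure.bind_apply hs
        ((η.comap (fun b => (a, b)) measurable_prodMk_left).aemeasurable (κ a))
    rw [this]
    exact κ.univMeasurable_lintegral ((Measure.measurable_coe hs).comp_univMeasurable η.meas)

/-- Image of a universally measurable kernel under a Borel map of source and target. -/
def map [MeasurableSpace.CountablyGenerated β] [MeasurableSpace.CountablyGenerated γ]
    (κ : UnivKernel α β) (g : α × β → γ) (hg : Measurable g) : UnivKernel α γ where
  toFun a := (κ a).map fun b => g (a, b)
  isProb a := Measure.isProbabilityMeasure_map (hg.comp measurable_prodMk_left).aemeasurable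
  meas := by
    have : (fun a => (κ a).map fun b => g (a, b)) =
        (κ.bind (ofKernel (Kernel.deterministic g hg))).toFun := by
      funext a
      simp only [bind, ofKernel, Kernel.deterministic_apply]
      exact (Measure.bind_dirac_eq_map _ (hg.comp measurable_prodMk_left)).symm
    rw [this]
    exact (κ.bind _).meas

/-- The σ-algebra on `α` is arbitrary, so that the universal completion can be inserted for it. -/
theorem _root_.exists_measurable_disintegration [StandardBorelSpace γ] [Nonempty γ]
    [MeasurableSpace.CountablyGenerated β] {κ : α → Measure (β × γ)} (hκ : Measurable κ)
    (hp : ∀ a, IsProbabilityMeasure (κ a)) :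
    ∃ η : α × β → Measure γ, Measurable η ∧ (∀ p, IsProbabilityMeasure (η p)) ∧
      ∀ a, κ a = (κ a).fst.bind fun b => (η (a, b)).map fun c => (b, c) := by
  let k : Kernel α (β × γ) := ⟨κ, hκ⟩
  have : IsMarkovKernel k := ⟨hp⟩
  refine ⟨k.condKernel, k.condKernel.measurable, fun p => inferInstance, fun a => ?_⟩
  have hmap : Measurable fun b => (k.condKernel (a, b)).map fun c => (b, c) := by
    refine Measure.measurable_of_measurable_coe _ fun s hs => ?_
    simp_rw [Measure.map_apply measurable_prodMk_left hs]
    exact Kernel.measurable_kernel_prodMk_left' hs a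
  ext s hs
  rw [Measure.bind_apply hs hmap.aemeasurable]
  conv_lhs => rw [show κ a = k a from rfl, ← k.disintegrate k.condKernel,
    Kernel.compProd_apply hs, Kernel.fst_apply]
  refine lintegral_congr fun b => ?_
  rw [Measure.map_apply measurable_prodMk_left hs]

/-- Disintegration of universally measurable kernels. -/
theorem exists_disintegration [StandardBorelSpace γ] [Nonempty γ]
    [MeasurableSpace.CountablyGenerated β] (κ : UnivKernel α (β × γ)) :
    ∃ η : UnivKernel (α × β) γ,
      ∀ a, κ a = (κ a).fst.bind fun b => (η (a, b)).map fun c => (b, c) := by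
  obtain ⟨η, hη, hp, h⟩ := @exists_measurable_disintegration α β γ (universalSigma α) _ _ _ _ _ _
    κ.meas κ.isProb
  -- The product of the completed σ-algebra on `α` with that of `β` lies inside the universal
  -- completion of the product.
  refine ⟨⟨η, hp, hη.mono (sup_le ?_ ?_) le_rfl⟩, h⟩
  · exact measurable_iff_comap_le.1 measurable_fst.measurable_universalSigma
  · exact (measurable_iff_comap_le.1 measurable_snd).trans le_universalSigma

end UnivKernel

/-! ### Value functions -/

theorem truncL_mem (r : ℝ) : truncL r ∈ Icc (0 : ℝ) 1 :=
  ⟨le_min zero_le_one (le_max_left _ _), min_le_left _ _⟩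

theorem truncL_mono {r s : ℝ} (h : r ≤ s) : truncL r ≤ truncL s :=
  min_le_min le_rfl (max_le_max le_rfl h)

namespace GMDP

section Values

variable {Y : Type w} [MeasurableSpace Y] (M : GMDP.{u, v, w} Y) {K : Set Y} {δ : ℝ}

/-- The transition kernel of `M` under a randomised control law. -/
def transKernel (ν : UnivKernel M.X M.A) : UnivKernel M.X M.X :=
  ν.bind (UnivKernel.ofKernel M.T)

instance (x : M.X) (ν : UnivKernel M.X M.A) : IsProbabilityMeasure (M.trans x (ν x)) :=
  (M.transKernel ν).isProb x

theorem gain_of_mem {V : M.X → ℝ} {x : M.X} (hx : M.h x ∈ K) : M.gain K V x = 1 := by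
  simp [gain, hx]

theorem gain_of_notMem {V : M.X → ℝ} {x : M.X} (hx : M.h x ∉ K) : M.gain K V x = V x := by
  simp [gain, hx]

theorem gain_mem {V : M.X → ℝ} (hV : ∀ x, V x ∈ Icc (0 : ℝ) 1) (x : M.X) :
    M.gain K V x ∈ Icc (0 : ℝ) 1 := by
  by_cases hx : M.h x ∈ K
  · rw [M.gain_of_mem hx]; simp
  · rw [M.gain_of_notMem hx]; exact hV x

theorem gain_mono {V V' : M.X → ℝ} (h : V ≤ V') : M.gain K V ≤ M.gain K V' := fun x => by
  by_cases hx : M.h x ∈ K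
  · rw [M.gain_of_mem hx, M.gain_of_mem hx]
  · rw [M.gain_of_notMem hx, M.gain_of_notMem hx]; exact h x

theorem univMeasurable_gain (hK : MeasurableSet K) {V : M.X → ℝ} (hV : UnivMeasurable V) :
    UnivMeasurable (M.gain K V) :=
  univMeasurable_of_aemeasurable fun m _ =>
    (aemeasurable_const.indicator (M.h_meas hK)).add
      ((hV.aemeasurable m).indicator (M.h_meas hK).compl)

theorem integrable_gain (hK : MeasurableSet K) {V : M.X → ℝ} (hV : UnivMeasurable V)
    (hV' : ∀ x, V x ∈ Icc (0 : ℝ) 1) (m : Measure M.X) [IsFiniteMeasure m] :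
    Integrable (M.gain K V) m :=
  Integrable.of_mem_Icc 0 1 ((M.univMeasurable_gain hK hV).aemeasurable m)
    (Filter.Eventually.of_forall (M.gain_mem hV'))

theorem univMeasurable_opT (hK : MeasurableSet K) (ν : UnivKernel M.X M.A) {V : M.X → ℝ}
    (hV : UnivMeasurable V) (hV' : ∀ x, V x ∈ Icc (0 : ℝ) 1) :
    UnivMeasurable (M.opT K δ ν V) := by
  have h1 : ∀ x, ∫ x', M.gain K V x' ∂(M.trans x (ν x)) =
      (∫⁻ x', ENNReal.ofReal (M.gain K V x') ∂(M.transKernel ν x)).toReal := fun x =>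
    integral_eq_lintegral_of_nonneg_ae
      (Filter.Eventually.of_forall fun x' => (M.gain_mem hV' x').1)
      (M.integrable_gain hK hV hV' _).1
  have h2 : UnivMeasurable fun x =>
      ∫⁻ x', ENNReal.ofReal (M.gain K V x') ∂(M.transKernel ν x) :=
    (M.transKernel ν).univMeasurable_lintegral
      (φ := fun p : M.X × M.X => ENNReal.ofReal (M.gain K V p.2))
      (ENNReal.measurable_ofReal.comp_univMeasurable
        ((M.univMeasurable_gain hK hV).comp_measurable measurable_snd))
  have h3 : Measurable fun y : ℝ≥0∞ => truncL (y.toReal - δ) := by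
    unfold truncL; fun_prop
  have h4 : M.opT K δ ν V = fun x =>
      truncL ((∫⁻ x', ENNReal.ofReal (M.gain K V x') ∂(M.transKernel ν x)).toReal - δ) := by
    funext x; rw [opT, h1]
  rw [h4]
  exact h3.comp_univMeasurable h2

theorem value_of_lt {μ : M.MarkovPolicy} {N k : ℕ} (h : k < N) :
    M.value K δ μ N k = M.opT K δ (μ k) (M.value K δ μ N (k + 1)) := by
  rw [value, if_pos h]

theorem value_of_le {μ : M.MarkovPolicy} {N k : ℕ} (h : N ≤ k) : M.value K δ μ N k = 0 := by
  rw [value, if_neg h.not_gt]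

theorem valueStar_of_lt {N k : ℕ} (h : k < N) :
    M.valueStar K δ N k = M.opTStar K δ (M.valueStar K δ N (k + 1)) := by
  rw [valueStar, if_pos h]

theorem valueStar_of_le {N k : ℕ} (h : N ≤ k) : M.valueStar K δ N k = 0 := by
  rw [valueStar, if_neg h.not_gt]

theorem value_mem (μ : M.MarkovPolicy) (N k : ℕ) (x : M.X) :
    M.value K δ μ N k x ∈ Icc (0 : ℝ) 1 := by
  rcases lt_or_ge k N with h | h
  · rw [M.value_of_lt h]; exact truncL_mem _
  · rw [M.value_of_le h]; simp

theorem univMeasurable_value (hK : MeasurableSet K) (μ : M.MarkovPolicy) (N k : ℕ) :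
    UnivMeasurable (M.value K δ μ N k) := by
  rcases le_total N k with h | h
  · rw [M.value_of_le h]; exact measurable_zero.univMeasurable
  induction h using Nat.decreasingInduction with
  | self => rw [M.value_of_le le_rfl]; exact measurable_zero.univMeasurable
  | of_succ k hk ih =>
    rw [M.value_of_lt hk]
    exact M.univMeasurable_opT hK _ ih (M.value_mem μ N (k + 1))

theorem opT_mono (hK : MeasurableSet K) (ν : UnivKernel M.X M.A) {V V' : M.X → ℝ}
    (hV : UnivMeasurable V) (hV₀ : ∀ x, V x ∈ Icc (0 : ℝ) 1)
    (hV' : UnivMeasurable V') (hV₀' : ∀ x, V' x ∈ Icc (0 : ℝ) 1) (h : V ≤ V') (x : M.X) :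
    M.opT K δ ν V x ≤ M.opT K δ ν V' x :=
  truncL_mono (sub_le_sub_right (integral_mono (M.integrable_gain hK hV hV₀ _)
    (M.integrable_gain hK hV' hV₀' _) (M.gain_mono h)) δ)

theorem robustValue_mono (hK : MeasurableSet K) {V V' : M.X → ℝ}
    (hV : UnivMeasurable V) (hV₀ : ∀ x, V x ∈ Icc (0 : ℝ) 1)
    (hV' : UnivMeasurable V') (hV₀' : ∀ x, V' x ∈ Icc (0 : ℝ) 1) (h : V ≤ V') :
    M.robustValue K δ V ≤ M.robustValue K δ V' :=
  truncL_mono (sub_le_sub_right (integral_mono (M.integrable_gain hK hV hV₀ _)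
    (M.integrable_gain hK hV' hV₀' _) (M.gain_mono h)) δ)

/-- The truncation at `1` bounds the family, so the real supremum is a genuine one. -/
theorem opT_le_opTStar (ν : UnivKernel M.X M.A) (V : M.X → ℝ) (x : M.X) :
    M.opT K δ ν V x ≤ M.opTStar K δ V x :=
  le_ciSup (f := fun ν : UnivKernel M.X M.A => M.opT K δ ν V x)
    ⟨1, by rintro _ ⟨ν, rfl⟩; exact (truncL_mem _).2⟩ ν

/-- Besides giving optimality, this settles the measurability of `valueStar`, which is not evident
for a supremum over all `ν` but is inherited from the value of a policy. -/
theorem value_eq_valueStar {N : ℕ} {μ : M.MarkovPolicy} (hμ : M.IsArgsupPolicy K δ N μ) {k : ℕ}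
    (hk : k ≤ N) : M.value K δ μ N k = M.valueStar K δ N k := by
  induction hk using Nat.decreasingInduction with
  | self => rw [M.value_of_le le_rfl, M.valueStar_of_le le_rfl]
  | of_succ k hk ih =>
    rw [M.value_of_lt hk, M.valueStar_of_lt hk, ih]
    exact funext (hμ k hk)

/-- An argsup policy dominates all Markov policies. -/
theorem value_le_value_of_isArgsupPolicy (hK : MeasurableSet K) {N : ℕ} {μ : M.MarkovPolicy}
    (hμ : M.IsArgsupPolicy K δ N μ) (μ' : M.MarkovPolicy) {k : ℕ} (hk : k ≤ N) :
    M.value K δ μ' N k ≤ M.value K δ μ N k := by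
  induction hk using Nat.decreasingInduction with
  | self => rw [M.value_of_le le_rfl, M.value_of_le le_rfl]
  | of_succ k hk ih =>
    intro x
    rw [M.value_eq_valueStar hμ hk.le, M.valueStar_of_lt hk, M.value_of_lt hk,
      ← M.value_eq_valueStar hμ hk]
    exact (M.opT_mono hK _ (M.univMeasurable_value hK _ _ _) (M.value_mem _ _ _)
      (M.univMeasurable_value hK _ _ _) (M.value_mem _ _ _) ih x).trans (M.opT_le_opTStar _ _ x)

end Values

end GMDP

/-! ### The law of the execution -/

namespace ControlStrategy

variable {Y : Type w} [MeasurableSpace Y] {M : GMDP.{u, v, w} Y}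

/-- The transition of the controlled model as a universally measurable kernel. -/
def stepKernel (C : ControlStrategy.{u, v, w, t} M) :
    UnivKernel (M.X × C.XC) (M.X × C.XC) :=
  (C.TC.comap Prod.swap measurable_swap).bind
    (((C.hC.comap (fun p : (M.X × C.XC) × C.XC => p.2) measurable_snd).bind
      (UnivKernel.ofKernel (M.T.comap
        (fun p : ((M.X × C.XC) × C.XC) × M.A => (p.1.1.1, p.2)) (by fun_prop)))).map
      (fun p : ((M.X × C.XC) × C.XC) × M.X => (p.2, p.1.2)) (by fun_prop))

theorem measurable_snoc (X : Type*) [MeasurableSpace X] (n : ℕ) :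
    Measurable fun p : (Fin (n + 1) → X) × X => Fin.snoc (α := fun _ => X) p.1 p.2 := by
  refine measurable_pi_lambda _ fun i => ?_
  refine Fin.lastCases ?_ (fun j => ?_) i
  · simpa using measurable_snd
  · simpa [Function.comp_def] using (measurable_pi_apply j).comp measurable_fst

instance isProbabilityMeasure_execLaw (C : ControlStrategy.{u, v, w, t} M) (n : ℕ) :
    IsProbabilityMeasure (C.execLaw n) := by
  induction n with
  | zero =>
    exact Measure.isProbabilityMeasure_map (by fun_prop)
  | succ n ih =>
    let κ : UnivKernel (Fin (n + 1) → M.X × C.XC) (Fin (n + 2) → M.X × C.XC) :=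
      (C.stepKernel.comap (fun ω => ω (Fin.last n)) (measurable_pi_apply _)).map _
        (measurable_snoc (M.X × C.XC) n)
    exact isProbabilityMeasure_bind (κ.aemeasurable _) (Filter.Eventually.of_forall κ.isProb)

/-- A family of functions that dominates the conditional probability of avoiding `K` along the
execution bounds the probability of reaching `K` from below. -/
theorem le_reachProb (C : ControlStrategy.{u, v, w, t} M) {K : Set Y} (hK : MeasurableSet K)
    (N : ℕ) (r : ℝ) (hr : r ≤ 1) (ψ : ℕ → M.X × C.XC → ℝ≥0∞)
    (h_init : ∫⁻ x, (M.h ⁻¹' K)ᶜ.indicator (fun x => ψ 0 (x, C.c₀)) x ∂M.init ≤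
      ENNReal.ofReal (1 - r))
    (h_step : ∀ n z, ∫⁻ z', {z : M.X × C.XC | M.h z.1 ∉ K}.indicator (ψ (n + 1)) z' ∂(C.step z) ≤
      ψ n z)
    (h_last : ∀ z, 1 ≤ ψ N z) : r ≤ C.reachProb K N := by
  -- Supermartingale argument: the integral of `ψ n` over the executions that have avoided `K` so
  -- far stays below its initial bound. The `ψ n` need not be measurable, because the integral
  -- against an image or a mixture is always at most the iterated one.
  have key : ∀ n, ∫⁻ ω, {ω : Fin (n + 1) → M.X × C.XC | ∀ i, M.h (ω i).1 ∉ K}.indicator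
      (fun ω => ψ n (ω (Fin.last n))) ω ∂(C.execLaw n) ≤ ENNReal.ofReal (1 - r) := by
    intro n
    induction n with
    | zero =>
      refine (lintegral_map_le _ _).trans (le_trans (lintegral_mono fun x => ?_) h_init)
      by_cases hx : M.h x ∈ K <;> simp [hx]
    | succ n ih =>
      refine (Measure.lintegral_bind_le _ _ _).trans (le_trans (lintegral_mono fun ω => ?_) ih)
      refine (lintegral_map_le _ _).trans ?_
      by_cases hω : ∀ i, M.h (ω i).1 ∉ K
      · rw [indicator_of_mem (show ω ∈ {ω : Fin (n + 1) → M.X × C.XC | ∀ i, M.h (ω i).1 ∉ K}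
          from hω)]
        refine le_trans (lintegral_mono fun z => ?_) (h_step n (ω (Fin.last n)))
        by_cases hz : M.h z.1 ∈ K
        · rw [indicator_of_notMem]
          · exact zero_le
          · intro h
            have := h (Fin.last (n + 1))
            simp only [Fin.snoc_last] at this
            exact this hz
        · rw [indicator_of_mem (show z ∈ {z : M.X × C.XC | M.h z.1 ∉ K} from hz)]
          refine (indicator_le_self _ _ _).trans ?_
          simp
      · refine le_trans (le_of_eq ?_) zero_le
        refine (lintegral_congr fun z => ?_).trans lintegral_zero
        refine indicator_of_notMem (fun h => hω fun i => ?_) _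
        have := h i.castSucc
        simpa only [Fin.snoc_castSucc] using this
  have hfail : C.execLaw N {ω | ∀ i, M.h (ω i).1 ∉ K} ≤ ENNReal.ofReal (1 - r) := by
    refine le_trans ?_ (key N)
    rw [← lintegral_indicator_one]
    · refine lintegral_mono fun ω => ?_
      exact indicator_le_indicator (h_last _)
    · rw [(ext (fun ω => by simp) : {ω : Fin (N + 1) → M.X × C.XC | ∀ i, M.h (ω i).1 ∉ K} =
        ⋂ i, (fun ω => M.h (ω i).1) ⁻¹' Kᶜ)]
      exact MeasurableSet.iInter fun i =>
        (M.h_meas.comp (measurable_fst.comp (measurable_pi_apply i))) hK.compl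
  have hfail' : (C.execLaw N).real {ω | ∀ i, M.h (ω i).1 ∉ K} ≤ 1 - r :=
    ENNReal.toReal_le_of_le_ofReal (by linarith) hfail
  have hcover : (1 : ℝ) ≤ C.reachProb K N + (C.execLaw N).real {ω | ∀ i, M.h (ω i).1 ∉ K} := by
    have h1 := measureReal_union_le (μ := C.execLaw N)
      {ω | ∃ i : Fin (N + 1), M.h (ω i).1 ∈ K} {ω | ∀ i, M.h (ω i).1 ∉ K}
    rwa [show {ω : Fin (N + 1) → M.X × C.XC | ∃ i : Fin (N + 1), M.h (ω i).1 ∈ K} ∪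
      {ω | ∀ i, M.h (ω i).1 ∉ K} = univ by
        ext ω; simpa [not_exists] using em (∃ i, M.h (ω i).1 ∈ K), probReal_univ] at h1
  linarith

end ControlStrategy

/-! ### Liftings -/

theorem MeasureTheory.Measure.map_bind_of_aemeasurable {α β γ : Type*} [MeasurableSpace α]
    [MeasurableSpace β] [MeasurableSpace γ] {m : Measure α} {κ : α → Measure β}
    (hκ : AEMeasurable κ m) {g : β → γ} (hg : Measurable g) :
    (m.bind κ).map g = m.bind fun a => (κ a).map g := by
  rw [← Measure.bind_dirac_eq_map _ hg,
    Measure.bind_bind (g := fun b => Measure.dirac (g b)) hκ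
      (Measure.measurable_dirac.comp hg).aemeasurable]
  simp_rw [Measure.bind_dirac_eq_map _ hg]

/-- Disintegration of a universally measurable kernel along the second coordinate. -/
theorem UnivKernel.exists_disintegration_snd {α β γ : Type*} [MeasurableSpace α]
    [MeasurableSpace β] [MeasurableSpace γ] [StandardBorelSpace γ] [Nonempty γ]
    [MeasurableSpace.CountablyGenerated β] (κ : UnivKernel α (γ × β)) :
    ∃ η : UnivKernel (α × β) γ,
      ∀ a, κ a = (κ a).snd.bind fun b => (η (a, b)).map fun c => (c, b) := by
  obtain ⟨η, hη⟩ := (κ.map (fun p : α × γ × β => p.2.swap) (by fun_prop)).exists_disintegration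
  refine ⟨η, fun a => ?_⟩
  have h := congrArg (Measure.map Prod.swap) (hη a)
  have hm : (κ.map (fun p : α × γ × β => p.2.swap) (by fun_prop)) a = (κ a).map Prod.swap := rfl
  rw [hm, Measure.map_map measurable_swap measurable_swap, Prod.swap_swap_eq, Measure.map_id,
    Measure.fst_map_swap, Measure.map_bind_of_aemeasurable _ measurable_swap] at h
  · conv_lhs => rw [h]
    refine congrArg _ (funext fun b => ?_)
    rw [Measure.map_map measurable_swap measurable_prodMk_left]
    rfl
  · exact ((η.map (fun p : (α × β) × γ => (p.1.2, p.2)) (by fun_prop)).comap (fun b => (a, b))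
      measurable_prodMk_left).aemeasurable _

section Lifting

variable {X₁ : Type u₁} {X₂ : Type u₂} [MeasurableSpace X₁] [MeasurableSpace X₂]
  {R : Set (X₁ × X₂)} {δ : ℝ} {Δ : Measure X₁} {Θ : Measure X₂} {W : Measure (X₁ × X₂)}

/-- Bound on the integral of a function that is dominated by `1 - g` on the relation. -/
theorem IsLifting.lintegral_le (hW : IsLifting R δ Δ Θ W) (hR : MeasurableSet R)
    {g : X₁ → ℝ} (hg : AEMeasurable g Δ) (hg' : ∀ x, g x ∈ Icc (0 : ℝ) 1)
    {f : X₁ × X₂ → ℝ≥0∞} (hf : ∀ p, f p ≤ 1) (hfR : ∀ p ∈ R, f p ≤ ENNReal.ofReal (1 - g p.1)) :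
    ∫⁻ p, f p ∂W ≤ ENNReal.ofReal (1 - truncL (∫ x, g x ∂Δ - δ)) := by
  have := hW.prob
  -- The mere existence of a lifting forces this.
  have hδ : 0 ≤ δ := by
    have h1 := hW.rel_ge
    have h2 : W.real R ≤ 1 := measureReal_le_one
    linarith
  have hΔ : IsProbabilityMeasure Δ := by rw [← hW.fst_eq]; infer_instance
  have hgW : AEMeasurable (fun p : X₁ × X₂ => g p.1) W := by
    refine AEMeasurable.comp_measurable ?_ measurable_fst
    have := hW.fst_eq
    rw [Measure.fst] at this
    rwa [this]
  have hgi : Integrable (fun p : X₁ × X₂ => g p.1) W :=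
    Integrable.of_mem_Icc 0 1 hgW (Filter.Eventually.of_forall fun p => hg' p.1)
  have hgint : ∫ p, g p.1 ∂W = ∫ x, g x ∂Δ := by
    have h := hW.fst_eq
    rw [Measure.fst] at h
    rw [← h]
    refine (integral_map measurable_fst.aemeasurable ?_).symm
    rw [h]
    exact hg.aestronglyMeasurable
  have h1 : ∫⁻ p, f p ∂W ≤ 1 := (lintegral_mono hf).trans (by simp)
  have h2 : ∫⁻ p, f p ∂W ≤ ENNReal.ofReal (1 - ∫ x, g x ∂Δ + δ) := by
    calc ∫⁻ p, f p ∂W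
        -- Off `R` the crude bound `f ≤ 1` costs `W Rᶜ ≤ δ`.
        ≤ ∫⁻ p, (ENNReal.ofReal (1 - g p.1) + Rᶜ.indicator 1 p) ∂W := by
          refine lintegral_mono fun p => ?_
          by_cases hp : p ∈ R
          · exact (hfR p hp).trans le_self_add
          · refine (hf p).trans ?_
            simp [hp]
      _ = ENNReal.ofReal (1 - ∫ x, g x ∂Δ) + W Rᶜ := by
          rw [lintegral_add_right _ (measurable_one.indicator hR.compl),
            lintegral_indicator_one hR.compl,
            ← ofReal_integral_eq_lintegral_ofReal (f := fun p : X₁ × X₂ => 1 - g p.1)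
              ((integrable_const 1).sub hgi)
              (Filter.Eventually.of_forall fun p => sub_nonneg.2 (hg' p.1).2),
            integral_sub (integrable_const 1) hgi, hgint]
          simp
      _ ≤ ENNReal.ofReal (1 - ∫ x, g x ∂Δ) + ENNReal.ofReal δ := by
          gcongr
          rw [← ofReal_measureReal]
          refine ENNReal.ofReal_le_ofReal ?_
          rw [probReal_compl_eq_one_sub hR]
          linarith [hW.rel_ge]
      _ = _ := by
          rw [← ENNReal.ofReal_add _ hδ]
          rw [← hgint, sub_nonneg]
          refine (integral_mono hgi (integrable_const 1) fun p => (hg' p.1).2).trans ?_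
          simp
  -- Cutting off at `1` only weakens the claim; the two entries of the maximum correspond to the
  -- bounds `h1` and `h2`.
  have h3 : truncL (∫ x, g x ∂Δ - δ) ≤ max 0 (∫ x, g x ∂Δ - δ) := min_le_right _ _
  rcases le_max_iff.1 h3 with h | h
  · exact h1.trans (ENNReal.one_le_ofReal.2 (by linarith))
  · exact h2.trans (ENNReal.ofReal_le_ofReal (by linarith))

end Lifting

/-! ### The refined strategy -/

namespace Simulation

section Refinement

variable {Y : Type w} [MetricSpace Y] [MeasurableSpace Y]
  {M₁ : GMDP.{u₁, v₁, w} Y} {M₂ : GMDP.{u₂, v₂, w} Y} {ε δ : ℝ} (S : Simulation M₁ M₂ ε δ)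

/-- The lifting kernel under a randomised control law for `M₁`. -/
def mixedLift (ν : UnivKernel M₁.X M₁.A) : UnivKernel (M₁.X × M₂.X) (M₁.X × M₂.X) :=
  (ν.comap Prod.fst measurable_fst).bind (UnivKernel.ofKernel
    (S.W.comap (fun p : (M₁.X × M₂.X) × M₁.A => (p.2, p.1.1, p.1.2)) (by fun_prop)))

/-- The interface under a randomised control law for `M₁`. -/
def mixedInterface (ν : UnivKernel M₁.X M₁.A) : UnivKernel (M₁.X × M₂.X) M₂.A :=
  (ν.comap Prod.fst measurable_fst).bind (UnivKernel.ofKernel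
    (S.U.comap (fun p : (M₁.X × M₂.X) × M₁.A => (p.2, p.1.1, p.1.2)) (by fun_prop)))

/-- Both marginal conditions and the lower bound on the mass of `R` survive averaging over the
control `a₁`; associativity of `bind` identifies the second marginal. -/
theorem isLifting_mixedLift (ν : UnivKernel M₁.X M₁.A) {p : M₁.X × M₂.X} (hp : p ∈ S.R) :
    IsLifting S.R δ (M₁.trans p.1 (ν p.1)) (M₂.trans p.2 (S.mixedInterface ν p))
      (S.mixedLift ν p) := by
  have hW : Measurable fun a : M₁.A => S.W (a, p.1, p.2) :=
    S.W.measurable.comp (by fun_prop)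
  have hU : Measurable fun a : M₁.A => S.U (a, p.1, p.2) :=
    S.U.measurable.comp (by fun_prop)
  have hT : Measurable fun a : M₂.A => M₂.T (p.2, a) := M₂.T.measurable.comp (by fun_prop)
  have hl := S.lift_trans p.1 p.2 hp
  refine ⟨(S.mixedLift ν).isProb p, ?_, ?_, ?_⟩
  · change ((ν p.1).bind fun a => S.W (a, p.1, p.2)).map Prod.fst = _
    rw [Measure.map_bind_of_aemeasurable hW.aemeasurable measurable_fst]
    exact congrArg _ (funext fun a => (hl a).fst_eq)
  · change ((ν p.1).bind fun a => S.W (a, p.1, p.2)).map Prod.snd =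
      ((ν p.1).bind fun a => S.U (a, p.1, p.2)).bind fun a => M₂.T (p.2, a)
    rw [Measure.map_bind_of_aemeasurable hW.aemeasurable measurable_snd,
      Measure.bind_bind hU.aemeasurable hT.aemeasurable]
    exact congrArg _ (funext fun a => (hl a).snd_eq)
  · have h1 : ENNReal.ofReal (1 - δ) ≤ S.mixedLift ν p S.R := by
      change _ ≤ ((ν p.1).bind fun a => S.W (a, p.1, p.2)) S.R
      rw [Measure.bind_apply S.R_meas hW.aemeasurable]
      calc ENNReal.ofReal (1 - δ) = ∫⁻ _, ENNReal.ofReal (1 - δ) ∂(ν p.1) := by simp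
        _ ≤ _ := lintegral_mono fun a => by
          rw [← ofReal_measureReal]
          exact ENNReal.ofReal_le_ofReal (hl a).rel_ge
    exact (ENNReal.ofReal_le_iff_le_toReal (measure_ne_top _ _)).1 h1

variable (μ : M₁.MarkovPolicy) (W₀ : Measure (M₁.X × M₂.X)) [IsProbabilityMeasure W₀]

/-- The law of the next pair of states: the initial coupling `W₀` while the clock is negative, and
the lifting kernel under the policy thereafter. -/
def pairKernel : UnivKernel (ℤ × M₁.X × M₂.X) (M₁.X × M₂.X) :=
  UnivKernel.ofFamily fun k : ℤ =>
    if 0 ≤ k then S.mixedLift (μ k.toNat) else UnivKernel.ofKernel (Kernel.const _ W₀)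

theorem pairKernel_natCast (k : ℕ) (p : M₁.X × M₂.X) :
    S.pairKernel μ W₀ ((k : ℤ), p) = S.mixedLift (μ k) p := by
  simp [pairKernel, UnivKernel.ofFamily]

theorem pairKernel_neg_one (p : M₁.X × M₂.X) : S.pairKernel μ W₀ (-1, p) = W₀ := by
  simp [pairKernel, UnivKernel.ofFamily, UnivKernel.ofKernel]

variable [Nonempty M₁.X]

/-- The conditional law of the state of `M₁` given that of `M₂` under `pairKernel`. -/
def condPair : UnivKernel ((ℤ × M₁.X × M₂.X) × M₂.X) M₁.X :=
  (S.pairKernel μ W₀).exists_disintegration_snd.choose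

theorem pairKernel_eq_bind (c : ℤ × M₁.X × M₂.X) :
    S.pairKernel μ W₀ c = (S.pairKernel μ W₀ c).snd.bind fun x =>
      (S.condPair μ W₀ (c, x)).map fun x₁ => (x₁, x) :=
  (S.pairKernel μ W₀).exists_disintegration_snd.choose_spec c

/-- The update of the clock and of the pair of states. -/
def update : UnivKernel ((ℤ × M₁.X × M₂.X) × M₂.X) (ℤ × M₁.X × M₂.X) :=
  (S.condPair μ W₀).map
    (fun p : ((ℤ × M₁.X × M₂.X) × M₂.X) × M₁.X => (p.1.1.1 + 1, p.2, p.1.2)) (by fun_prop)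

theorem update_apply (c : ℤ × M₁.X × M₂.X) (x : M₂.X) :
    S.update μ W₀ (c, x) = (S.condPair μ W₀ (c, x)).map fun x₁ => (c.1 + 1, x₁, x) := rfl

theorem ae_update (c : ℤ × M₁.X × M₂.X) (x : M₂.X) :
    ∀ᵐ c' ∂(S.update μ W₀ (c, x)), c'.1 = c.1 + 1 ∧ c'.2.2 = x := by
  rw [update_apply, ae_map_iff (by fun_prop)]
  · simp
  · exact (measurable_fst (measurableSet_singleton (c.1 + 1))).inter
      ((measurable_snd.comp measurable_snd) (measurableSet_singleton x))

/-- Marginal and conditional law recombine. Once the second marginal is recognised as the true law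
of the measured state, this yields `init` and `transition` of `Refines`. -/
theorem map_bind_update (c : ℤ × M₁.X × M₂.X) :
    ((S.pairKernel μ W₀ c).snd.bind fun x => S.update μ W₀ (c, x)).map (fun c' => c'.2) =
      S.pairKernel μ W₀ c := by
  conv_rhs => rw [pairKernel_eq_bind]
  rw [Measure.map_bind_of_aemeasurable (κ := fun x => S.update μ W₀ (c, x))
    (((S.update μ W₀).comap (fun x => (c, x)) measurable_prodMk_left).aemeasurable _)
    measurable_snd]
  refine congrArg _ (funext fun x => ?_)
  rw [update_apply, Measure.map_map measurable_snd (by fun_prop)]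
  rfl

theorem lintegral_condPair (c : ℤ × M₁.X × M₂.X) {f : M₁.X × M₂.X → ℝ≥0∞}
    (hf : UnivMeasurable f) :
    ∫⁻ x, ∫⁻ x₁, f (x₁, x) ∂(S.condPair μ W₀ (c, x)) ∂(S.pairKernel μ W₀ c).snd =
      ∫⁻ p, f p ∂(S.pairKernel μ W₀ c) := by
  have hm : AEMeasurable (fun x => (S.condPair μ W₀ (c, x)).map fun x₁ => (x₁, x))
      (S.pairKernel μ W₀ c).snd :=
    (((S.condPair μ W₀).map
      (fun p : ((ℤ × M₁.X × M₂.X) × M₂.X) × M₁.X => (p.2, p.1.2)) (by fun_prop)).comap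
        (fun x => (c, x)) measurable_prodMk_left).aemeasurable _
  conv_rhs => rw [pairKernel_eq_bind]
  rw [Measure.lintegral_bind hm (by rw [← pairKernel_eq_bind]; exact hf.aemeasurable _)]
  refine lintegral_congr fun x => ?_
  rw [lintegral_map' (hf.aemeasurable _) measurable_prodMk_right.aemeasurable]

/-- The strategy that reconstructs the state of `M₁` from the measured states of `M₂`. -/
def refinedStrategy : ControlStrategy.{u₂, v₂, w, max u₁ u₂} M₂ where
  XC := ℤ × M₁.X × M₂.X
  -- The stored pair is immaterial: at clock `-1` the law `pairKernel` ignores it.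
  c₀ := (-1, Classical.arbitrary M₁.X, Classical.choice M₂.init.nonempty_of_neZero)
  TC := S.update μ W₀
  -- Controls are drawn after the update, when the clock is already nonnegative, so the value of
  -- `toNat` at `-1` plays no role in the execution.
  hC := UnivKernel.ofFamily fun k : ℤ => S.mixedInterface (μ k.toNat)

theorem refines_refinedStrategy (hW₀ : IsLifting S.R δ M₁.init M₂.init W₀) :
    Refines S μ (S.refinedStrategy μ W₀) (fun c => Prod.fst c) (fun c => (Prod.snd c).1)
      (fun c => (Prod.snd c).2) where
  q_meas := measurable_fst
  ξ₁_meas := measurable_fst.comp measurable_snd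
  ξ₂_meas := measurable_snd.comp measurable_snd
  clock_init := rfl
  update := S.ae_update μ W₀
  init := by
    have h := S.map_bind_update μ W₀ (S.refinedStrategy μ W₀).c₀
    rw [show S.pairKernel μ W₀ (S.refinedStrategy μ W₀).c₀ = W₀ from
      S.pairKernel_neg_one μ W₀ _, hW₀.snd_eq] at h
    convert! hW₀
  control := by
    rintro ⟨q, p⟩ k hq -
    obtain rfl : q = k := hq
    rfl
  transition := by
    rintro ⟨q, p⟩ k hq hp
    obtain rfl : q = k := hq
    have h := S.map_bind_update μ W₀ ((k : ℤ), p)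
    rw [pairKernel_natCast, (S.isLifting_mixedLift (μ k) hp).snd_eq] at h
    exact h

end Refinement

/-! ### Avoidance bounds for the refined strategy -/

section Reach

variable {Y : Type w} [MetricSpace Y] [MeasurableSpace Y] {K : Set Y}
  {M₁ : GMDP.{u₁, v₁, w} Y} {M₂ : GMDP.{u₂, v₂, w} Y} {δ : ℝ} (S : Simulation M₁ M₂ 0 δ)

/-- The upper bound on the probability of avoiding the target that a value function yields: the
complement of the value on the relation, and `1` off the relation. -/
def avoidBound (V : M₁.X → ℝ) (p : M₁.X × M₂.X) : ℝ≥0∞ :=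
  S.R.indicator (fun p => ENNReal.ofReal (1 - V p.1)) p + S.Rᶜ.indicator 1 p

theorem avoidBound_of_mem (V : M₁.X → ℝ) {p : M₁.X × M₂.X} (hp : p ∈ S.R) :
    S.avoidBound V p = ENNReal.ofReal (1 - V p.1) := by
  simp [avoidBound, hp]

theorem avoidBound_of_notMem (V : M₁.X → ℝ) {p : M₁.X × M₂.X} (hp : p ∉ S.R) :
    S.avoidBound V p = 1 := by
  simp [avoidBound, hp]

theorem avoidBound_le_one {V : M₁.X → ℝ} (hV : ∀ x, V x ∈ Icc (0 : ℝ) 1) (p : M₁.X × M₂.X) :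
    S.avoidBound V p ≤ 1 := by
  by_cases hp : p ∈ S.R
  · rw [S.avoidBound_of_mem V hp]
    exact ENNReal.ofReal_le_one.2 (by linarith [(hV p.1).1])
  · rw [S.avoidBound_of_notMem V hp]

theorem univMeasurable_avoidBound {V : M₁.X → ℝ} (hV : UnivMeasurable V) :
    UnivMeasurable (S.avoidBound V) := by
  refine univMeasurable_of_aemeasurable fun m _ => ?_
  have h : UnivMeasurable fun p : M₁.X × M₂.X => ENNReal.ofReal (1 - V p.1) :=
    Measurable.comp_univMeasurable (f := fun r : ℝ => ENNReal.ofReal (1 - r)) (by fun_prop)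
      (hV.comp_measurable measurable_fst)
  exact ((h.aemeasurable m).indicator S.R_meas).add
    (measurable_one.indicator S.R_meas.compl).aemeasurable

/-- Under a lifting, the mass of avoiding the target is controlled by the truncated gain. -/
theorem lintegral_avoidBound_le (hK : MeasurableSet K) {V : M₁.X → ℝ} (hV : UnivMeasurable V)
    (hV' : ∀ x, V x ∈ Icc (0 : ℝ) 1) {Δ : Measure M₁.X} {Θ : Measure M₂.X}
    {W : Measure (M₁.X × M₂.X)} (hW : IsLifting S.R δ Δ Θ W) :
    ∫⁻ p, {p : M₁.X × M₂.X | M₂.h p.2 ∉ K}.indicator (S.avoidBound V) p ∂W ≤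
      ENNReal.ofReal (1 - truncL (∫ x, M₁.gain K V x ∂Δ - δ)) := by
  have := hW.prob
  have hΔ : IsProbabilityMeasure Δ := by rw [← hW.fst_eq]; infer_instance
  refine hW.lintegral_le S.R_meas ((M₁.univMeasurable_gain hK hV).aemeasurable Δ)
    (M₁.gain_mem hV') (fun p => (indicator_le_self _ _ _).trans (S.avoidBound_le_one hV' p))
    fun p hp => ?_
  -- The only use of `ε = 0`: on the relation both models hit `K` simultaneously.
  have hh : M₁.h p.1 = M₂.h p.2 := dist_le_zero.1 (S.dist_le p.1 p.2 hp)
  by_cases hpK : M₂.h p.2 ∈ K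
  · simp [hpK]
  · rw [indicator_of_mem (show p ∈ {p : M₁.X × M₂.X | M₂.h p.2 ∉ K} from hpK),
      S.avoidBound_of_mem V hp, M₁.gain_of_notMem (hh ▸ hpK)]

variable (μ : M₁.MarkovPolicy)

/-- The bound on the conditional probability of avoiding the target after the `n`-th state of `M₂`
has been measured. -/
def postBound (K : Set Y) (N n : ℕ)
    (c : ℤ × M₁.X × M₂.X) : ℝ≥0∞ :=
  if c.1 = n then S.avoidBound (M₁.value K δ μ N n) c.2 else 1

theorem postBound_of_eq {N n : ℕ} {c : ℤ × M₁.X × M₂.X} (h : c.1 = n) :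
    S.postBound μ K N n c = S.avoidBound (M₁.value K δ μ N n) c.2 :=
  if_pos h

theorem postBound_of_ne {N n : ℕ} {c : ℤ × M₁.X × M₂.X} (h : c.1 ≠ n) :
    S.postBound μ K N n c = 1 :=
  if_neg h

theorem postBound_le_one (N n : ℕ) (c : ℤ × M₁.X × M₂.X) : S.postBound μ K N n c ≤ 1 := by
  unfold postBound
  split_ifs
  · exact S.avoidBound_le_one (M₁.value_mem μ N n) c.2
  · exact le_rfl

variable (W₀ : Measure (M₁.X × M₂.X)) [IsProbabilityMeasure W₀] [Nonempty M₁.X]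

/-- The bound on the conditional probability of avoiding the target before the `n`-th state of `M₂`
is measured. -/
def preBound (K : Set Y) (N n : ℕ) (z : M₂.X × ℤ × M₁.X × M₂.X) : ℝ≥0∞ :=
  ∫⁻ c', S.postBound μ K N n c' ∂(S.update μ W₀ (z.2, z.1))

theorem preBound_le_one (N n : ℕ) (z : M₂.X × ℤ × M₁.X × M₂.X) :
    S.preBound μ W₀ K N n z ≤ 1 :=
  (lintegral_mono (S.postBound_le_one μ N n)).trans (by simp)

theorem one_le_preBound (N : ℕ) (z : M₂.X × ℤ × M₁.X × M₂.X) : 1 ≤ S.preBound μ W₀ K N N z := by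
  have h : ∀ c, S.postBound μ K N N c = 1 := fun c => by
    unfold postBound
    split_ifs
    · rw [M₁.value_of_le le_rfl]
      by_cases hp : c.2 ∈ S.R
      · simp [S.avoidBound_of_mem _ hp]
      · exact S.avoidBound_of_notMem _ hp
    · rfl
  simp [preBound, h]

/-- Measuring `x ∼ Θ` and then updating reassembles the pair law, to which `lintegral_avoidBound_le`
applies. It serves the initial coupling (clock `-1`, `n = 0`) and all later steps alike. -/
theorem lintegral_preBound_le (hK : MeasurableSet K) (N n : ℕ) {c : ℤ × M₁.X × M₂.X}
    (hc : c.1 + 1 = n) {Δ : Measure M₁.X} {Θ : Measure M₂.X}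
    (hW : IsLifting S.R δ Δ Θ (S.pairKernel μ W₀ c)) :
    ∫⁻ x, (M₂.h ⁻¹' K)ᶜ.indicator (fun x => S.preBound μ W₀ K N n (x, c)) x ∂Θ ≤
      ENNReal.ofReal (1 - truncL (∫ x, M₁.gain K (M₁.value K δ μ N n) x ∂Δ - δ)) := by
  have hV := M₁.univMeasurable_value (δ := δ) hK μ N n
  refine le_trans ?_ (S.lintegral_avoidBound_le hK hV (M₁.value_mem μ N n) hW)
  rw [← S.lintegral_condPair, hW.snd_eq]
  · refine lintegral_mono fun x => ?_
    by_cases hx : M₂.h x ∈ K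
    · simp [hx]
    · rw [indicator_of_mem (show x ∈ (M₂.h ⁻¹' K)ᶜ from hx)]
      refine (lintegral_map_le _ _).trans (lintegral_mono fun x₁ => ?_)
      rw [indicator_of_mem (show (x₁, x) ∈ {p : M₁.X × M₂.X | M₂.h p.2 ∉ K} from hx)]
      simp [postBound, hc]
  · refine univMeasurable_of_aemeasurable fun m _ => ?_
    exact ((S.univMeasurable_avoidBound hV).aemeasurable m).indicator
      ((M₂.h_meas.comp measurable_snd) hK.compl)

theorem lintegral_step_preBound_le (hK : MeasurableSet K) (N n : ℕ)
    (z : M₂.X × ℤ × M₁.X × M₂.X) :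
    ∫⁻ z', {z : M₂.X × ℤ × M₁.X × M₂.X | M₂.h z.1 ∉ K}.indicator
      (S.preBound μ W₀ K N (n + 1)) z' ∂((S.refinedStrategy μ W₀).step z) ≤
      S.preBound μ W₀ K N n z := by
  obtain ⟨x, c⟩ := z
  refine (Measure.lintegral_bind_le _ _ _).trans (lintegral_mono_ae ?_)
  filter_upwards [S.ae_update μ W₀ c x] with c' hc'
  refine (lintegral_map_le _ _).trans ?_
  change ∫⁻ x', (M₂.h ⁻¹' K)ᶜ.indicator (fun x' => S.preBound μ W₀ K N (n + 1) (x', c')) x'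
    ∂(M₂.trans x (S.mixedInterface (μ c'.1.toNat) c'.2)) ≤ _
  have hone : ∫⁻ x', (M₂.h ⁻¹' K)ᶜ.indicator
      (fun x' => S.preBound μ W₀ K N (n + 1) (x', c')) x'
      ∂(M₂.trans x (S.mixedInterface (μ c'.1.toNat) c'.2)) ≤ 1 := by
    have : IsProbabilityMeasure (M₂.trans x (S.mixedInterface (μ c'.1.toNat) c'.2)) :=
      isProbabilityMeasure_bind (M₂.T.measurable.comp measurable_prodMk_left).aemeasurable
        (Filter.Eventually.of_forall fun a => inferInstance)
    calc _ ≤ ∫⁻ _, 1 ∂(M₂.trans x (S.mixedInterface (μ c'.1.toNat) c'.2)) :=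
          lintegral_mono fun x' => (indicator_le_self _
            (fun x' => S.preBound μ W₀ K N (n + 1) (x', c')) x').trans
            (S.preBound_le_one μ W₀ N (n + 1) (x', c'))
      _ = 1 := by simp
  -- Only with the right clock, a related pair and `n < N` is there something to prove; otherwise
  -- the right-hand side is `1` and `hone` suffices.
  by_cases hcn : c'.1 = n
  · by_cases hp : c'.2 ∈ S.R
    · rcases lt_or_ge n N with hn | hn
      · obtain ⟨q, x₁, x₂⟩ := c'
        -- The update has stored the measured state, so the transition law of `M₂` from it is the
        -- second marginal of the lifting at the stored pair.
        obtain ⟨-, rfl⟩ : _ ∧ x₂ = x := hc'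
        obtain rfl : q = n := hcn
        have hl := S.isLifting_mixedLift (μ n) hp
        rw [← S.pairKernel_natCast μ W₀] at hl
        refine (S.lintegral_preBound_le μ W₀ hK N (n + 1) (by push_cast; rfl) hl).trans ?_
        simp only [postBound, if_true]
        rw [S.avoidBound_of_mem _ hp, M₁.value_of_lt hn]
        rfl
      · refine hone.trans (le_of_eq ?_)
        rw [S.postBound_of_eq μ hcn, S.avoidBound_of_mem _ hp, M₁.value_of_le hn]
        simp
    · rw [S.postBound_of_eq μ hcn, S.avoidBound_of_notMem _ hp]
      exact hone
  · rw [S.postBound_of_ne μ hcn]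
    exact hone

/-- The `- δ` in `robustValue` pays for the initial coupling `W₀`, which the clock value `-1`
selects. -/
theorem robustValue_le_reachProb (hK : MeasurableSet K) (N : ℕ)
    (hW₀ : IsLifting S.R δ M₁.init M₂.init W₀) :
    M₁.robustValue K δ (M₁.value K δ μ N 0) ≤ (S.refinedStrategy μ W₀).reachProb K N := by
  refine (S.refinedStrategy μ W₀).le_reachProb hK N _ (truncL_mem _).2 (S.preBound μ W₀ K N) ?_
    (S.lintegral_step_preBound_le μ W₀ hK N) (S.one_le_preBound μ W₀ N)
  refine S.lintegral_preBound_le μ W₀ hK N 0 rfl ?_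
  exact (S.pairKernel_neg_one μ W₀ _).symm ▸ hW₀

/-- Along every simulation some strategy refines the policy and attains its robust value. -/
theorem exists_refines (hK : MeasurableSet K) (N : ℕ) (S : Simulation M₁ M₂ 0 δ) :
    ∃ (C : ControlStrategy.{u₂, v₂, w, max u₁ u₂} M₂)
      (q : C.XC → ℤ) (ξ₁ : C.XC → M₁.X) (ξ₂ : C.XC → M₂.X),
      Refines S μ C q ξ₁ ξ₂ ∧
      M₁.robustValue K δ (M₁.value K δ μ N 0) ≤ C.reachProb K N := by
  obtain ⟨W₀, hW₀⟩ := S.lift_init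
  have := hW₀.prob
  exact ⟨_, _, _, _, S.refines_refinedStrategy μ W₀ hW₀,
    S.robustValue_le_reachProb μ W₀ hK N hW₀⟩

end Reach

end Simulation

theorem robustlyReaches_value {Y : Type w} [MetricSpace Y] [MeasurableSpace Y]
    (M₁ : GMDP.{u₁, v₁, w} Y) (μ : M₁.MarkovPolicy) {K : Set Y} (hK : MeasurableSet K)
    (N : ℕ) (δ : ℝ) :
    RobustlyReaches.{u₁, v₁, u₂, v₂, w} M₁ μ K N 0 δ
      (M₁.robustValue K δ (M₁.value K δ μ N 0)) := by
  rintro M₂ ⟨S⟩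
  have : Nonempty M₁.X := M₁.init.nonempty_of_neZero
  obtain ⟨C, -, -, -, -, h⟩ := S.exists_refines μ hK N
  exact ⟨C, h⟩

end

theorem theorem1 {Y : Type w} [MetricSpace Y] [MeasurableSpace Y] [BorelSpace Y]
    (M₁ : GMDP.{u₁, v₁, w} Y) (μ : M₁.MarkovPolicy) (K : Set Y) (hK : MeasurableSet K)
    (N : ℕ) (δ : ℝ) :
    -- `K` is reached robustly with the policy `μ` and with the stated probability
    RobustlyReaches.{u₁, v₁, u₂, v₂, w} M₁ μ K N 0 δ
        (M₁.robustValue K δ (M₁.value K δ μ N 0)) ∧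
    -- this is witnessed, along every simulation, by a strategy that refines `μ`
    (∀ (M₂ : GMDP.{u₂, v₂, w} Y) (S : Simulation M₁ M₂ 0 δ),
      ∃ (C₂ : ControlStrategy.{u₂, v₂, w, max u₁ u₂} M₂)
        (q : C₂.XC → ℤ) (ξ₁ : C₂.XC → M₁.X) (ξ₂ : C₂.XC → M₂.X),
        Refines S μ C₂ q ξ₁ ξ₂ ∧
        M₁.robustValue K δ (M₁.value K δ μ N 0) ≤ C₂.reachProb K N) ∧
    -- a policy obtained from the sup-recursion is an optimal robust policy
    (∀ μs : M₁.MarkovPolicy, M₁.IsArgsupPolicy K δ N μs →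
      (∀ k ≤ N, M₁.value K δ μs N k = M₁.valueStar K δ N k) ∧
      RobustlyReaches.{u₁, v₁, u₂, v₂, w} M₁ μs K N 0 δ
        (M₁.robustValue K δ (M₁.valueStar K δ N 0)) ∧
      ∀ μ' : M₁.MarkovPolicy,
        M₁.robustValue K δ (M₁.value K δ μ' N 0) ≤
          M₁.robustValue K δ (M₁.valueStar K δ N 0)) := by
  have : Nonempty M₁.X := M₁.init.nonempty_of_neZero
  refine ⟨robustlyReaches_value M₁ μ hK N δ, fun M₂ S => S.exists_refines μ hK N,
    fun μs hμs => ⟨fun k hk => M₁.value_eq_valueStar hμs hk, ?_, fun μ' => ?_⟩⟩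
  · rw [← M₁.value_eq_valueStar hμs N.zero_le]
    exact robustlyReaches_value M₁ μs hK N δ
  · rw [← M₁.value_eq_valueStar hμs N.zero_le]
    exact M₁.robustValue_mono hK (M₁.univMeasurable_value hK _ _ _) (M₁.value_mem _ _ _)
      (M₁.univMeasurable_value hK _ _ _) (M₁.value_mem _ _ _)
      (M₁.value_le_value_of_isArgsupPolicy hK hμs μ' N.zero_le)
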